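/- Let $k\ge 1$, $0\le t\le k$ and $r\ge 1$ be integers. A $k_t$-Dyck path is a lattice path with up-steps $(1,k)$ and down-steps $(1,-1)$ that starts at $(0,0)$, stays weakly above the line $y=-t$, and ends on the line $y=0$. Let $$S_{t,r}(x,u)=\sum_{P} x^{\mathrm{up}(P)}\,u^{d_r(P)}$$ where the sum runs over all $k_t$-Dyck paths $P$ (including the empty path), $\mathrm{up}(P)$ is the number of up-steps of $P$, and $d_r(P)$ is the number of down-steps of $P$ between its $r$-th and $(r+1)$-th up-steps (after its $r$-th up-step if $P$ has exactly $r$ up-steps, and $d_r(P)=0$ if $P$ has fewer than $r$ up-steps). Put $$C_{j,t}=\frac{t+1}{(k+1)j+t+1}\binom{(k+1)j+t+1}{j}.$$ Then, after the substitution $x=z(1-z)^k$, the following identity of formal series in $z$ holds: $$\partial_u S_{t,r}(x,u)\big|_{u=1}=\frac{1-(1-z)^{t+1}}{z(1-z)^t}-\sum_{j=1}^{r}z^{j-1}(1-z)^{kj}\,C_{j,t}+\sum_{j=1}^{r-1}z^{j}(1-z)^{kj}\,C_{j,t}-t\,z^r(1-z)^{kr}\,C_{r,t}.$$ -/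

import Mathlib

/-- The two kinds of steps of a path: `up` is the step `(1, k)`, `down` is the step `(1, -1)`. -/
inductive Step where
  | up : Step
  | down : Step
deriving DecidableEq

/-- The change of height caused by a step, for a given `k`. -/
def Step.rise (k : ℕ) : Step → ℤ
  | Step.up => k
  | Step.down => -1

/-- The height at which a path that starts at `(0, 0)` ends. -/
def pathHeight (k : ℕ) (p : List Step) : ℤ := (p.map (Step.rise k)).sum

/-- A `k_t`-Dyck path: every point of the path (the end point of a prefix `q` of `p`) lies weakly
above the line `y = -t`, and the path ends on the line `y = 0`. -/
def IsDyckPath (k t : ℕ) (p : List Step) : Prop :=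
  (∀ q : List Step, q <+: p → -(t : ℤ) ≤ pathHeight k q) ∧ pathHeight k p = 0

/-- The set of `k_t`-Dyck paths with exactly `n` up-steps. -/
def dyckPathSet (k t n : ℕ) : Set (List Step) :=
  {p | IsDyckPath k t p ∧ p.count Step.up = n}

theorem pathHeight_add_length (k : ℕ) (p : List Step) :
    pathHeight k p + p.length = (k + 1) * (p.count Step.up : ℤ) := by
  induction p with
  | nil => simp [pathHeight]
  | cons s p ih =>
    unfold pathHeight at ih ⊢
    cases s
    · simp only [List.map_cons, List.sum_cons, Step.rise, List.length_cons, List.count_cons_self]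
      push_cast
      linarith
    · rw [List.count_cons_of_ne (by decide)]
      simp only [List.map_cons, List.sum_cons, Step.rise, List.length_cons]
      push_cast
      linarith

/-- A `k_t`-Dyck path with `n` up-steps has length `(k + 1) n`. -/
theorem length_of_mem_dyckPathSet {k t n : ℕ} {p : List Step} (hp : p ∈ dyckPathSet k t n) :
    p.length = (k + 1) * n := by
  have h := pathHeight_add_length k p
  rw [hp.1.2, hp.2] at h
  zify
  linarith

instance : Fintype Step := ⟨{Step.up, Step.down}, by intro s; cases s <;> decide⟩

theorem dyckPathSet_finite (k t n : ℕ) : (dyckPathSet k t n).Finite :=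
  (List.finite_length_eq Step ((k + 1) * n)).subset fun _ hp => length_of_mem_dyckPathSet hp

/-- The finite set of `k_t`-Dyck paths with exactly `n` up-steps. -/
noncomputable def dyckPaths (k t n : ℕ) : Finset (List Step) := (dyckPathSet_finite k t n).toFinset

/-- `downSteps r p` is the number of down-steps of `p` that lie between the `r`-th and the
`(r+1)`-th up-step, that is, the down-steps that are preceded by exactly `r` up-steps. (For `r = 0`
these are the down-steps before the first up-step; if there are exactly `r` up-steps, these are the
down-steps after the `r`-th up-step; if there are fewer than `r` up-steps, the number is `0`.) -/
def downSteps : ℕ → List Step → ℕ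
  | _, [] => 0
  | 0, Step.up :: _ => 0
  | 0, Step.down :: p => downSteps 0 p + 1
  | r + 1, Step.up :: p => downSteps r p
  | r + 1, Step.down :: p => downSteps (r + 1) p

/-- The bivariate generating function `S_{t,r}(x, u)` of `k_t`-Dyck paths, a power series in `x`
whose coefficients are polynomials in `u`: the exponent of `x` is the number of up-steps, and the
exponent of `u` is the number of down-steps between the `r`-th and `(r+1)`-th up-steps. -/
noncomputable def dyckGF (k t r : ℕ) : PowerSeries (Polynomial ℚ) :=
  PowerSeries.mk fun n => ∑ p ∈ dyckPaths k t n, (Polynomial.X : Polynomial ℚ) ^ downSteps r p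

/-- The partial derivative `∂_u F(x, u)` of a power series in `x` over the polynomials in `u`. -/
noncomputable def partialU (F : PowerSeries (Polynomial ℚ)) : PowerSeries (Polynomial ℚ) :=
  PowerSeries.mk fun n => Polynomial.derivative (PowerSeries.coeff n F)

/-- The specialization `F(x, 1)` of a power series in `x` over the polynomials in `u`. -/
noncomputable def evalUOne (F : PowerSeries (Polynomial ℚ)) : PowerSeries ℚ :=
  PowerSeries.map (Polynomial.evalRingHom (1 : ℚ)) F

/-- The result `F(z (1 - z) ^ k)` of substituting `x = z (1 - z) ^ k` into a power series `F(x)`,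
as a power series in `z`. -/
noncomputable def substZ (k : ℕ) (F : PowerSeries ℚ) : PowerSeries ℚ :=
  F.subst ((PowerSeries.X : PowerSeries ℚ) * (1 - PowerSeries.X) ^ k)

/-- The substitution `x = z (1 - z) ^ k` is a legitimate substitution of formal power series. -/
theorem hasSubst_substZ (k : ℕ) :
    PowerSeries.HasSubst ((PowerSeries.X : PowerSeries ℚ) * (1 - PowerSeries.X) ^ k) :=
  PowerSeries.HasSubst.of_constantCoeff_zero' (by simp)

/-- The generalized Fuss--Catalan number
`C_{j,t} = (t+1) / ((k+1) j + t + 1) * binom((k+1) j + t + 1, j)`. -/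
def genFussCatalan (k j t : ℕ) : ℚ :=
  ((t : ℚ) + 1) / (((k : ℚ) + 1) * j + t + 1) * (((k + 1) * j + t + 1).choose j : ℚ)

/-- The variable `z`, as an element of the field of formal Laurent series in `z` over `ℚ`. -/
noncomputable def zVar : LaurentSeries ℚ := ((PowerSeries.X : PowerSeries ℚ) : LaurentSeries ℚ)

open PowerSeries

/-! Raise the paths by `t` and let the starting height `m` vary while the end height stays `t`.
Splitting off the first step gives recurrences in `m`. At x = z(1-z)^k, with W = 1/(1-z), they are
solved by powers of W, because zW^(m+1) = W^(m+1) - W^m (`walkSeries_one`). Weighting by `downSteps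
r`, an up-step lowers `r` by one and a down-step from positive height only lowers `m`, except that
for `r = 0` it also adds 1. This gives the closed form `X_mul_walkSeries_downSteps` for every `m`,
since C_{j,m} obeys the same first-step recurrence. The theorem is the case `m = t`, divided by z.
-/

/-- `IsWalk k t n m p` says that the path `p`, started at height `m`, stays weakly above `0`, ends at
height `t` and has exactly `n` up-steps. -/
def IsWalk (k t n m : ℕ) (p : List Step) : Prop :=
  (∀ q : List Step, q <+: p → 0 ≤ (m : ℤ) + pathHeight k q) ∧
    (m : ℤ) + pathHeight k p = t ∧ p.count Step.up = n

theorem pathHeight_cons (k : ℕ) (s : Step) (p : List Step) :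
    pathHeight k (s :: p) = s.rise k + pathHeight k p := by
  simp [pathHeight]

theorem forall_prefix_cons {P : List Step → Prop} {s : Step} {p : List Step} :
    (∀ q, q <+: s :: p → P q) ↔ P [] ∧ ∀ q, q <+: p → P (s :: q) := by
  constructor
  · intro h
    exact ⟨h [] List.nil_prefix, fun q hq => h _ (List.cons_prefix_cons.2 ⟨rfl, hq⟩)⟩
  · rintro ⟨h0, h1⟩ q hq
    rcases List.prefix_cons_iff.1 hq with rfl | ⟨q', rfl, hq'⟩
    · exact h0
    · exact h1 _ hq'

theorem isWalk_nil {k t n m : ℕ} : IsWalk k t n m [] ↔ m = t ∧ n = 0 := by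
  simp [IsWalk, pathHeight, eq_comm]

theorem isWalk_up_zero {k t m : ℕ} {p : List Step} : ¬ IsWalk k t 0 m (Step.up :: p) := by
  simp [IsWalk]

theorem isWalk_up_succ {k t n m : ℕ} {p : List Step} :
    IsWalk k t (n + 1) m (Step.up :: p) ↔ IsWalk k t n (m + k) p := by
  simp only [IsWalk, forall_prefix_cons, pathHeight_cons, Step.rise, List.count_cons_self,
    Nat.cast_add, add_assoc, Nat.add_right_cancel_iff]
  simp [pathHeight]

theorem isWalk_down_zero {k t n : ℕ} {p : List Step} : ¬ IsWalk k t n 0 (Step.down :: p) := by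
  rintro ⟨h, -⟩
  have := h [Step.down] (by simp)
  simp [pathHeight, Step.rise] at this

theorem isWalk_down_succ {k t n m : ℕ} {p : List Step} :
    IsWalk k t n (m + 1) (Step.down :: p) ↔ IsWalk k t n m p := by
  have hc : (Step.down :: p).count Step.up = p.count Step.up :=
    List.count_cons_of_ne (by decide)
  have hz (a : ℤ) : ((m + 1 : ℕ) : ℤ) + (-1 + a) = m + a := by push_cast; ring
  simp only [IsWalk, forall_prefix_cons, pathHeight_cons, Step.rise, hc, hz]
  have h0 : 0 ≤ ((m + 1 : ℕ) : ℤ) + pathHeight k [] := by simp [pathHeight]; positivity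
  rw [and_iff_right h0]

/-- The walks of `IsWalk` as a finite set, built by their first step. -/
def walks (k t : ℕ) : ℕ → ℕ → Finset (List Step)
  | 0, 0 => if 0 = t then {[]} else ∅
  | 0, m + 1 => (walks k t 0 m).map ⟨List.cons Step.down, List.cons_injective⟩ ∪
      if m + 1 = t then {[]} else ∅
  | n + 1, 0 => (walks k t n k).map ⟨List.cons Step.up, List.cons_injective⟩
  | n + 1, m + 1 => (walks k t (n + 1) m).map ⟨List.cons Step.down, List.cons_injective⟩ ∪
      (walks k t n (m + 1 + k)).map ⟨List.cons Step.up, List.cons_injective⟩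

theorem mem_walks {k t n m : ℕ} {p : List Step} : p ∈ walks k t n m ↔ IsWalk k t n m p := by
  induction n generalizing m p with
  | zero =>
    induction m generalizing p with
    | zero =>
      rcases p with - | ⟨_ | _, p⟩
      · rw [walks, isWalk_nil]
        split_ifs with h <;> simp [h]
      · refine iff_of_false ?_ isWalk_up_zero
        rw [walks]
        split_ifs <;> simp
      · refine iff_of_false ?_ isWalk_down_zero
        rw [walks]
        split_ifs <;> simp
    | succ m ih =>
      rcases p with - | ⟨_ | _, p⟩
      · rw [walks, isWalk_nil]
        split_ifs with h <;> simp [h]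
      · refine iff_of_false ?_ isWalk_up_zero
        rw [walks]
        split_ifs <;> simp
      · rw [walks, isWalk_down_succ, ← ih]
        split_ifs <;> simp
  | succ n ihn =>
    induction m generalizing p with
    | zero =>
      rcases p with - | ⟨_ | _, p⟩
      · rw [walks, isWalk_nil]
        simp
      · rw [walks, isWalk_up_succ, ← ihn, zero_add]
        simp
      · refine iff_of_false ?_ isWalk_down_zero
        rw [walks]
        simp
    | succ m ih =>
      rcases p with - | ⟨_ | _, p⟩
      · rw [walks, isWalk_nil]
        simp
      · rw [walks, isWalk_up_succ, ← ihn]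
        simp
      · rw [walks, isWalk_down_succ, ← ih]
        simp

theorem dyckPaths_eq_walks (k t n : ℕ) : dyckPaths k t n = walks k t n t := by
  ext p
  rw [mem_walks]
  simp only [dyckPaths, Set.Finite.mem_toFinset, dyckPathSet, IsDyckPath, IsWalk, Set.mem_ofPred_eq,
    neg_le_iff_add_nonneg', add_eq_left, and_assoc]

/-! ### First-step recurrences for weighted walk counts -/

/-- The sum of a weight over the walks with `n` up-steps from height `m`. -/
def walkSum (k t : ℕ) (f : List Step → ℚ) (n m : ℕ) : ℚ := ∑ p ∈ walks k t n m, f p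

section walkSum

variable (k t : ℕ) (f : List Step → ℚ)

theorem walkSum_zero_zero : walkSum k t f 0 0 = if 0 = t then f [] else 0 := by
  unfold walkSum walks
  split_ifs <;> simp

theorem walkSum_zero_succ (m : ℕ) : walkSum k t f 0 (m + 1) =
    walkSum k t (fun p => f (Step.down :: p)) 0 m + if m + 1 = t then f [] else 0 := by
  unfold walkSum
  rw [walks, Finset.sum_union, Finset.sum_map]
  · congr 1
    split_ifs <;> simp
  · rw [Finset.disjoint_left]
    intro p hp
    obtain ⟨q, -, rfl⟩ := Finset.mem_map.1 hp
    split_ifs <;> simp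

theorem walkSum_succ_zero (n : ℕ) : walkSum k t f (n + 1) 0 =
    walkSum k t (fun p => f (Step.up :: p)) n k := by
  unfold walkSum
  rw [walks, Finset.sum_map]
  rfl

theorem walkSum_succ_succ (n m : ℕ) : walkSum k t f (n + 1) (m + 1) =
    walkSum k t (fun p => f (Step.down :: p)) (n + 1) m +
      walkSum k t (fun p => f (Step.up :: p)) n (m + 1 + k) := by
  unfold walkSum
  rw [walks, Finset.sum_union, Finset.sum_map, Finset.sum_map]
  · rfl
  · rw [Finset.disjoint_left]
    intro p hp
    obtain ⟨q, -, rfl⟩ := Finset.mem_map.1 hp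
    simp

end walkSum

/-! ### Generating functions in z -/

/-- The series `∑ a n xⁿ` at `x = z (1 - z) ^ k`. -/
noncomputable def xSeries (k : ℕ) (a : ℕ → ℚ) : PowerSeries ℚ := substZ k (PowerSeries.mk a)

theorem xSeries_add (k : ℕ) (a b : ℕ → ℚ) :
    xSeries k (fun n => a n + b n) = xSeries k a + xSeries k b := by
  unfold xSeries substZ
  rw [← PowerSeries.subst_add (hasSubst_substZ k)]
  rfl

theorem xSeries_zero (k : ℕ) : xSeries k (fun _ => 0) = 0 := by
  have := xSeries_add k (fun _ => 0) (fun _ => 0)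
  simpa using this

theorem xSeries_cons (k : ℕ) (a : ℕ → ℚ) :
    xSeries k a = PowerSeries.C (a 0) + X * (1 - X) ^ k * xSeries k (fun n => a (n + 1)) := by
  have h : PowerSeries.mk a =
      PowerSeries.C (a 0) + X * PowerSeries.mk (fun n => a (n + 1)) := by
    ext n
    cases n <;> simp [PowerSeries.coeff_succ_X_mul]
  unfold xSeries substZ
  rw [h, PowerSeries.subst_add (hasSubst_substZ k), PowerSeries.subst_mul (hasSubst_substZ k),
    PowerSeries.subst_X (hasSubst_substZ k), ← PowerSeries.coe_substAlgHom (hasSubst_substZ k)]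
  congr 1
  exact (PowerSeries.substAlgHom (hasSubst_substZ k)).commutes (a 0)

/-- The generating function of weighted walks from height `m`, at `x = z (1 - z) ^ k`. -/
noncomputable def walkSeries (k t : ℕ) (f : List Step → ℚ) (m : ℕ) : PowerSeries ℚ :=
  xSeries k (fun n => walkSum k t f n m)

section walkSeries

variable (k t : ℕ) (f : List Step → ℚ)

theorem walkSeries_zero : walkSeries k t f 0 = PowerSeries.C (if 0 = t then f [] else 0) +
    X * (1 - X) ^ k * walkSeries k t (fun p => f (Step.up :: p)) k := by
  rw [walkSeries, xSeries_cons]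
  simp only [walkSum_zero_zero, walkSum_succ_zero]
  rfl

theorem walkSeries_succ (m : ℕ) : walkSeries k t f (m + 1) =
    walkSeries k t (fun p => f (Step.down :: p)) m +
      PowerSeries.C (if m + 1 = t then f [] else 0) +
    X * (1 - X) ^ k * walkSeries k t (fun p => f (Step.up :: p)) (m + 1 + k) := by
  rw [walkSeries, xSeries_cons]
  simp only [walkSum_zero_succ, walkSum_succ_succ, xSeries_add]
  rw [walkSeries, xSeries_cons k (fun n => walkSum k t _ n m), map_add]
  unfold walkSeries
  ring

theorem walkSeries_weight_add (g : List Step → ℚ) (m : ℕ) :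
    walkSeries k t (fun p => f p + g p) m = walkSeries k t f m + walkSeries k t g m := by
  unfold walkSeries
  simp only [walkSum, Finset.sum_add_distrib, xSeries_add]

theorem walkSeries_weight_zero (m : ℕ) : walkSeries k t (fun _ => 0) m = 0 := by
  unfold walkSeries
  simp only [walkSum, Finset.sum_const_zero, xSeries_zero]

end walkSeries

/-- Uniqueness for the first-step recurrence: each up-step contributes a factor z, so every `D m` is
divisible by all powers of z. -/
theorem eq_zero_of_walk_recurrence {k : ℕ} {D : ℕ → PowerSeries ℚ}
    (h0 : D 0 = X * (1 - X) ^ k * D k)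
    (hs : ∀ m, D (m + 1) = D m + X * (1 - X) ^ k * D (m + 1 + k)) (m : ℕ) : D m = 0 := by
  have key (N : ℕ) : ∀ m, (X : PowerSeries ℚ) ^ N ∣ D m := by
    induction N with
    | zero => simp
    | succ N ih =>
      have hx (m : ℕ) : (X : PowerSeries ℚ) ^ (N + 1) ∣ X * (1 - X) ^ k * D m := by
        obtain ⟨c, hc⟩ := ih m
        exact ⟨(1 - X) ^ k * c, by rw [hc]; ring⟩
      intro m
      induction m with
      | zero => rw [h0]; exact hx k
      | succ m ihm => rw [hs]; exact dvd_add ihm (hx _)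
  ext n
  simpa using PowerSeries.X_pow_dvd_iff.1 (key (n + 1) m) n n.lt_succ_self

/-- The correction below height `t` accounts for the empty walk, which exists only at `m = t`. As `t
≤ k`, an up-step always lands where the correction vanishes. -/
theorem walkSeries_one {k t : ℕ} (ht : t ≤ k) {W : PowerSeries ℚ} (hW : W * (1 - X) = 1) (m : ℕ) :
    walkSeries k t (fun _ => 1) m = W ^ (m + 1) - PowerSeries.C (if m < t then 1 else 0) := by
  have hWk (i : ℕ) : (1 - X) ^ k * W ^ (i + k) = W ^ i := by
    rw [pow_add, mul_comm, mul_assoc, ← mul_pow, hW, one_pow, mul_one]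
  rw [← sub_eq_zero]
  refine eq_zero_of_walk_recurrence (k := k) (D := fun m => walkSeries k t (fun _ => 1) m -
    (W ^ (m + 1) - PowerSeries.C (if m < t then 1 else 0))) ?_ ?_ m
  · rw [walkSeries_zero, if_neg (by omega : ¬ k < t)]
    have h := hWk 1
    rw [add_comm 1 k] at h
    rcases Nat.eq_zero_or_pos t with rfl | h0
    · simp only [if_true, lt_irrefl, if_false, map_one, map_zero]
      linear_combination X * h - hW
    · rw [if_neg h0.ne, if_pos h0]
      simp only [map_one, map_zero]
      linear_combination X * h - hW
  · intro m
    rw [walkSeries_succ, if_neg (by omega : ¬ m + 1 + k < t)]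
    have h := hWk (m + 2)
    rw [show m + 2 + k = m + 1 + k + 1 by ring] at h
    rcases lt_trichotomy (m + 1) t with h0 | h0 | h0
    · rw [if_neg h0.ne, if_pos h0, if_pos (by omega)]
      simp only [map_one, map_zero]
      linear_combination X * h - W ^ (m + 1) * hW
    · rw [if_pos h0, if_neg (by omega), if_pos (by omega)]
      simp only [map_one, map_zero]
      linear_combination X * h - W ^ (m + 1) * hW
    · rw [if_neg h0.ne', if_neg (by omega), if_neg (by omega)]
      simp only [map_zero]
      linear_combination X * h - W ^ (m + 1) * hW

/-! ### Recurrences of the Fuss–Catalan numbers -/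

theorem genFussCatalan_zero (k t : ℕ) : genFussCatalan k 0 t = 1 := by
  have : (t : ℚ) + 1 ≠ 0 := by positivity
  simp [genFussCatalan, this]

theorem choose_succ_succ_cast (N j : ℕ) :
    ((N + 1).choose (j + 1) : ℚ) = (N + 1) * N.choose j / (j + 1) := by
  have h := Nat.add_one_mul_choose_eq N j
  have hj : (j : ℚ) + 1 ≠ 0 := by positivity
  rw [eq_div_iff hj]
  exact_mod_cast h.symm

theorem genFussCatalan_succ_zero (k j : ℕ) :
    genFussCatalan k (j + 1) 0 = genFussCatalan k j k := by
  unfold genFussCatalan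
  rw [show (k + 1) * (j + 1) + 0 + 1 = ((k + 1) * j + k + 1) + 1 by ring, choose_succ_succ_cast]
  have hj : (j : ℚ) + 1 ≠ 0 := by positivity
  have h1 : ((k : ℚ) + 1) * j + k + 1 ≠ 0 := by positivity
  have h2 : ((k : ℚ) + 1) * (j + 1) + 1 ≠ 0 := by positivity
  push_cast
  rw [add_zero]
  field_simp
  ring

/-- Coefficient form of W^(m+2) = W^(m+1) + xW^(m+2+k), as C_{j,m} is the coefficient of x^j in
W^(m+1). -/
theorem genFussCatalan_succ_succ (k j m : ℕ) : genFussCatalan k (j + 1) (m + 1) =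
    genFussCatalan k (j + 1) m + genFussCatalan k j (m + 1 + k) := by
  unfold genFussCatalan
  have hN : (k + 1) * (j + 1) + m + 1 = (k + 1) * j + (m + 1 + k) + 1 := by ring
  rw [show (k + 1) * (j + 1) + (m + 1) + 1 = ((k + 1) * j + (m + 1 + k) + 1) + 1 by ring, hN]
  rw [choose_succ_succ_cast]
  set N := (k + 1) * j + (m + 1 + k) + 1 with hNd
  have hNq : (N : ℚ) = (k + 1) * j + (m + 1 + k) + 1 := by rw [hNd]; push_cast; ring
  have hle : j ≤ N := by rw [hNd]; nlinarith
  have hc : (N.choose (j + 1) : ℚ) = N.choose j * (N - j) / (j + 1) := by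
    have hj : (j : ℚ) + 1 ≠ 0 := by positivity
    rw [eq_div_iff hj, ← Nat.cast_sub hle]
    exact_mod_cast Nat.choose_succ_right_eq N j
  rw [hc]
  have hj : (j : ℚ) + 1 ≠ 0 := by positivity
  have h1 : (N : ℚ) ≠ 0 := by rw [hNq]; positivity
  have h2 : (N : ℚ) + 1 ≠ 0 := by positivity
  push_cast
  rw [show ((k : ℚ) + 1) * (j + 1) + (m + 1) + 1 = N + 1 by rw [hNq]; ring,
    show ((k : ℚ) + 1) * (j + 1) + m + 1 = N by rw [hNq]; ring,
    show ((k : ℚ) + 1) * j + (m + 1 + k) + 1 = N by rw [hNq]]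
  field_simp
  rw [hNq]
  ring

/-! ### Series weighted by the number of down-steps -/

/-- Only an initial down-step contributes, so the series telescopes to the sum of `walkSeries_one`
over heights below `m`; the corrections there add up to `min m t`. -/
theorem X_mul_walkSeries_downSteps_zero {k t : ℕ} (ht : t ≤ k) {W : PowerSeries ℚ}
    (hW : W * (1 - X) = 1) (m : ℕ) :
    X * walkSeries k t (fun p => (downSteps 0 p : ℚ)) m =
      W ^ m - 1 - PowerSeries.C ((min m t : ℕ) : ℚ) * X := by
  induction m with
  | zero =>
    rw [walkSeries_zero]
    simp [downSteps, walkSeries_weight_zero]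
  | succ m ih =>
    rw [walkSeries_succ]
    simp only [downSteps, Nat.cast_zero, ite_self, map_zero, walkSeries_weight_zero, Nat.cast_add,
      Nat.cast_one, walkSeries_weight_add, walkSeries_one ht hW]
    rw [mul_zero, add_zero, add_zero, mul_add, ih]
    split_ifs with h
    · rw [min_eq_left h.le, min_eq_left (by omega : m + 1 ≤ t)]
      push_cast
      rw [map_add, map_one]
      linear_combination -W ^ m * hW
    · rw [min_eq_right (by omega : t ≤ m), min_eq_right (by omega : t ≤ m + 1), map_zero]
      linear_combination -W ^ m * hW

/-- The condition `hrm` makes `min m t = t` in the base case `r = 0`. It holds after any up-step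
because `t ≤ k`. -/
theorem X_mul_walkSeries_downSteps {k t : ℕ} (ht : t ≤ k) {W : PowerSeries ℚ}
    (hW : W * (1 - X) = 1) (r m : ℕ) (hrm : 1 ≤ r ∨ t ≤ m) :
    X * walkSeries k t (fun p => (downSteps r p : ℚ)) m =
      W ^ m - (1 - X) * ∑ j ∈ Finset.range r,
          PowerSeries.C (genFussCatalan k j m) * (X * (1 - X) ^ k) ^ j
        - PowerSeries.C (genFussCatalan k r m) * (X * (1 - X) ^ k) ^ r *
          (1 + PowerSeries.C (t : ℚ) * X) := by
  have hWk (i : ℕ) : (1 - X) ^ k * W ^ (i + k) = W ^ i := by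
    rw [pow_add, mul_comm, mul_assoc, ← mul_pow, hW, one_pow, mul_one]
  induction r generalizing m with
  | zero =>
    rw [X_mul_walkSeries_downSteps_zero ht hW, min_eq_right (by omega), genFussCatalan_zero]
    simp
    ring
  | succ r ih =>
    -- For positive index the condition is void; dropping it keeps the inner induction on `m`
    -- unconditional.
    clear hrm
    have hterm (i : ℕ) : X * (X * (1 - X) ^ k *
        walkSeries k t (fun p => (downSteps r p : ℚ)) (i + k)) =
        X * W ^ i - (1 - X) * ∑ j ∈ Finset.range r,
          PowerSeries.C (genFussCatalan k j (i + k)) * (X * (1 - X) ^ k) ^ (j + 1)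
        - PowerSeries.C (genFussCatalan k r (i + k)) * (X * (1 - X) ^ k) ^ (r + 1) *
          (1 + PowerSeries.C (t : ℚ) * X) := by
      rw [mul_left_comm, ih (i + k) (Or.inr (by omega))]
      simp only [pow_succ _ (_ : ℕ), ← mul_assoc, ← Finset.sum_mul]
      linear_combination X * hWk i
    -- Splitting off `j = 0` aligns the sum with the exponents `j + 1` in `hterm`.
    simp only [Finset.sum_range_succ', genFussCatalan_zero]
    induction m with
    | zero =>
      rw [walkSeries_zero]
      simp only [downSteps, Nat.cast_zero, ite_self, map_zero, zero_add]
      have h := hterm 0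
      rw [zero_add] at h
      rw [h]
      simp only [genFussCatalan_succ_zero, map_one]
      ring
    | succ m ihm =>
      rw [walkSeries_succ]
      simp only [downSteps, Nat.cast_zero, ite_self, map_zero, add_zero]
      rw [mul_add, ihm, hterm]
      simp only [genFussCatalan_succ_succ, map_add, add_mul, Finset.sum_add_distrib, map_one]
      linear_combination -W ^ m * hW

/-! ### Specialization to Dyck paths and Laurent series -/

theorem substZ_evalUOne_partialU_dyckGF (k t r : ℕ) :
    substZ k (evalUOne (partialU (dyckGF k t r))) =
      walkSeries k t (fun p => (downSteps r p : ℚ)) t := by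
  unfold walkSeries xSeries
  congr 1
  ext n
  simp [evalUOne, partialU, dyckGF, dyckPaths_eq_walks, walkSum, Polynomial.derivative_X_pow]

theorem theorem5p8 (k t r : ℕ) (hk : 1 ≤ k) (ht : t ≤ k) (hr : 1 ≤ r) :
    ((substZ k (evalUOne (partialU (dyckGF k t r))) : PowerSeries ℚ) : LaurentSeries ℚ) =
      (1 - (1 - zVar) ^ (t + 1)) / (zVar * (1 - zVar) ^ t)
        - ∑ j ∈ Finset.Icc 1 r,
            genFussCatalan k j t • (zVar ^ (j - 1) * (1 - zVar) ^ (k * j))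
        + ∑ j ∈ Finset.Icc 1 (r - 1),
            genFussCatalan k j t • (zVar ^ j * (1 - zVar) ^ (j * k))
        - ((t : ℚ) * genFussCatalan k r t) • (zVar ^ r * (1 - zVar) ^ (r * k)) := by
  obtain ⟨r, rfl⟩ : ∃ s, r = s + 1 := ⟨r - 1, by omega⟩
  have hu : (1 - X : PowerSeries ℚ)⁻¹ * (1 - X) = 1 := PowerSeries.inv_mul_cancel _ (by simp)
  have h := X_mul_walkSeries_downSteps ht hu (r + 1) t (Or.inl hr)
  rw [← substZ_evalUOne_partialU_dyckGF] at h
  generalize substZ k (evalUOne (partialU (dyckGF k t (r + 1)))) = S at h ⊢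
  generalize (1 - X : PowerSeries ℚ)⁻¹ = W at h hu
  have hz : zVar ≠ 0 := by
    unfold zVar
    exact fun h0 => PowerSeries.X_ne_zero
      (HahnSeries.ofPowerSeries_injective (h0.trans (map_zero _).symm))
  have hC (a : ℚ) : HahnSeries.ofPowerSeries ℤ ℚ (PowerSeries.C a) = HahnSeries.C a :=
    HahnSeries.ofPowerSeries_C a
  have hS (a : ℚ) (f : LaurentSeries ℚ) : HahnSeries.C a * f = a • f :=
    HahnSeries.C_mul_eq_smul
  have hX : HahnSeries.ofPowerSeries ℤ ℚ X = zVar := rfl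
  replace h := congrArg (HahnSeries.ofPowerSeries ℤ ℚ) h
  replace hu := congrArg (HahnSeries.ofPowerSeries ℤ ℚ) hu
  simp only [map_mul, map_sub, map_add, map_one, map_pow, map_sum, hC, hX] at h hu
  have hy : 1 - zVar ≠ 0 := right_ne_zero_of_mul_eq_one hu
  have hWt : HahnSeries.ofPowerSeries ℤ ℚ W ^ t * (1 - zVar) ^ t = 1 := by
    rw [← mul_pow, hu, one_pow]
  -- The subtracted `1 - zVar` is the `j = 0` term of the sum in `h`.
  have hd : (1 - (1 - zVar) ^ (t + 1)) / (zVar * (1 - zVar) ^ t) * zVar =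
      HahnSeries.ofPowerSeries ℤ ℚ W ^ t - (1 - zVar) := by
    rw [eq_div_of_mul_eq (pow_ne_zero t hy) hWt]
    field_simp
    ring
  apply mul_left_cancel₀ hz
  have hI (n : ℕ) (f : ℕ → LaurentSeries ℚ) :
      ∑ j ∈ Finset.Icc 1 n, f j = ∑ j ∈ Finset.range n, f (j + 1) := by
    rw [Finset.range_eq_Ico, Finset.sum_Ico_add' f 0 n 1]
    rfl
  rw [Nat.add_sub_cancel, hI, hI]
  rw [h, Finset.sum_range_succ']
  simp only [genFussCatalan_zero, ← hS, map_mul, map_one, Nat.add_sub_cancel]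
  rw [Finset.sum_range_succ]
  have h1 : zVar * ∑ j ∈ Finset.range r, HahnSeries.C (genFussCatalan k (j + 1) t) *
        (zVar ^ j * (1 - zVar) ^ (k * (j + 1))) =
      ∑ j ∈ Finset.range r,
        HahnSeries.C (genFussCatalan k (j + 1) t) * (zVar * (1 - zVar) ^ k) ^ (j + 1) := by
    rw [Finset.mul_sum]
    exact Finset.sum_congr rfl fun j _ => by rw [mul_pow, ← pow_mul]; ring
  have h2 : ∑ j ∈ Finset.range r, HahnSeries.C (genFussCatalan k (j + 1) t) *
        (zVar ^ (j + 1) * (1 - zVar) ^ ((j + 1) * k)) =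
      ∑ j ∈ Finset.range r,
        HahnSeries.C (genFussCatalan k (j + 1) t) * (zVar * (1 - zVar) ^ k) ^ (j + 1) :=
    Finset.sum_congr rfl fun j _ => by rw [mul_pow, ← pow_mul, mul_comm k]
  -- Expanding the factor `1 - zVar` in front of the sum in `h` yields the two sums of the
  -- statement.
  linear_combination h1 - zVar * h2 - hd
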